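/- For integers $d,w\ge 2$, a layered graph $G$ consists of $d$ layers $V_1,\dots,V_d$ with $V_i=\{v_{i,1},\dots,v_{i,w}\}$ and, for each $i\in\{1,\dots,d-1\}$, a perfect matching $M_i$ between $V_i$ and $V_{i+1}$; $P(G)\in\{1,\dots,w\}$ denotes the index $\ell$ of the unique vertex $v_{d,\ell}\in V_d$ joined to $v_{1,1}$ by the path that uses one edge of each of $M_1,\dots,M_{d-1}$. In the paired pointer chasing problem $\mathrm{PPC}_{d,w}$, a bit $b\in\{0,1\}$ is chosen uniformly at random, and then two layered graphs $G^1,G^2$ with matchings $M^1_i,M^2_i$: if $b=0$, all $2(d-1)$ matchings are uniform and independent; if $b=1$, they are uniform and independent conditioned on $P(G^1)=P(G^2)$. Let $\mu_{\mathrm{PPC}}$ be the resulting joint distribution of $b$ and $(G^1,G^2)$. Alice receives $M^1_i,M^2_i$ for all odd $i$, and Bob receives $M^1_i,M^2_i$ for all even $i$. The players exchange $d-2$ messages (finite bit strings), one per round, alternately and with Bob speaking first; in a deterministic protocol each message is a function of the sender's input and of the earlier messages. Afterwards the receiver of the last message (Bob if $d$ is even, Alice if $d$ is odd; in particular Bob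 if $d=2$, when there is no message) outputs a guess for $b$, as a function of that player's input and all messages. The cost of the protocol is the maximum length in bits of any single message, over all rounds and all inputs. There is an absolute constant $c>0$ such that for all integers $d,w\ge 2$, every deterministic protocol for $\mathrm{PPC}_{d,w}$ whose output equals $b$ with probability at least $0.95$ over $\mu_{\mathrm{PPC}}$ has cost at least $$c\cdot\left(\frac{w}{d^5}-\log_2 w\right).$$ -/

import Mathlib

/-- A layered graph with `d` layers `V_1, …, V_d` of `w` labelled vertices each, `V_i` being
identified with `Fin w`.  It is given by its `d - 1` perfect matchings: the entry with index `k`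
is the matching `M_{k+1}` between `V_{k+1}` and `V_{k+2}`, viewed as the bijection sending a vertex
of `V_{k+1}` to its partner in `V_{k+2}`. -/
abbrev LayeredGraph (d w : ℕ) : Type := Fin (d - 1) → Equiv.Perm (Fin w)

/-- The vertex of the last layer joined by a path to the vertex `v` of the first layer: follow
`M_1`, then `M_2`, …, then `M_{d-1}`. -/
def LayeredGraph.point {d w : ℕ} (G : LayeredGraph d w) (v : Fin w) : Fin w :=
  Fin.foldl (d - 1) (fun u k => G k u) v

/-- An input `(G¹, G²)` of paired pointer chasing. -/
abbrev PPCInput (d w : ℕ) : Type := LayeredGraph d w × LayeredGraph d w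

/-- What Alice may hold: for each odd `i ∈ [d-1]`, the pair of matchings `(M_i^1, M_i^2)`
(the index `k` stands for `i = k + 1`). -/
abbrev AliceInput (d w : ℕ) : Type :=
  {k : Fin (d - 1) // Odd (k.val + 1)} → Equiv.Perm (Fin w) × Equiv.Perm (Fin w)

/-- What Bob may hold: for each even `i ∈ [d-1]`, the pair of matchings `(M_i^1, M_i^2)`. -/
abbrev BobInput (d w : ℕ) : Type :=
  {k : Fin (d - 1) // Even (k.val + 1)} → Equiv.Perm (Fin w) × Equiv.Perm (Fin w)

/-- The part of the input that is given to Alice. -/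
def PPCInput.alice {d w : ℕ} (G : PPCInput d w) : AliceInput d w :=
  fun k => (G.1 k.1, G.2 k.1)

/-- The part of the input that is given to Bob. -/
def PPCInput.bob {d w : ℕ} (G : PPCInput d w) : BobInput d w :=
  fun k => (G.1 k.1, G.2 k.1)

/-- A deterministic two-party protocol.  A message is a finite bit string, which may depend on the
speaker's own input and on the list of all earlier messages; the answer of a player depends on the
player's own input and on the list of all messages. -/
structure DetProtocol (X Y : Type) where
  aliceMsg : X → List (List Bool) → List Bool
  bobMsg : Y → List (List Bool) → List Bool
  aliceOut : X → List (List Bool) → Bool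
  bobOut : Y → List (List Bool) → Bool

namespace DetProtocol

variable {X Y : Type}

/-- The next message after the list `t` of earlier messages.  Players alternate and Bob speaks
first: Bob sends the messages of rounds 1, 3, 5, … and Alice those of rounds 2, 4, 6, …. -/
def nextMsg (π : DetProtocol X Y) (x : X) (y : Y) (t : List (List Bool)) : List Bool :=
  if Odd (t.length + 1) then π.bobMsg y t else π.aliceMsg x t

/-- The messages of the first `r` rounds, in order. -/
def transcript (π : DetProtocol X Y) (x : X) (y : Y) : ℕ → List (List Bool)
  | 0 => []
  | r + 1 => π.transcript x y r ++ [π.nextMsg x y (π.transcript x y r)]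

/-- The answer after `R` rounds, given by the receiver of the last message: Alice if `R` is odd
(Bob sent the last message), Bob if `R` is even.  If `R = 0`, Bob answers. -/
def output (π : DetProtocol X Y) (R : ℕ) (x : X) (y : Y) : Bool :=
  if Odd R then π.aliceOut x (π.transcript x y R) else π.bobOut y (π.transcript x y R)

/-- The communication cost of the protocol when it is run for `R` rounds: the maximal length of
a message, over all rounds and all inputs. -/
def cost [Fintype X] [Fintype Y] (π : DetProtocol X Y) (R : ℕ) : ℕ :=
  (Finset.univ : Finset (X × Y)).sup fun p =>
    (Finset.range R).sup fun r => (π.nextMsg p.1 p.2 (π.transcript p.1 p.2 r)).length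

end DetProtocol

/-- The inputs with `P(G¹, v_{1,1}) = P(G², v_{1,1})`, where `v_{1,1}` is `0 : Fin w`. -/
def PPCInput.equalPointers (d w : ℕ) [NeZero w] : Finset (PPCInput d w) :=
  Finset.univ.filter fun G => G.1.point 0 = G.2.point 0

theorem PPCInput.equalPointers_nonempty (d w : ℕ) [NeZero w] :
    (PPCInput.equalPointers d w).Nonempty :=
  ⟨(1, 1), by simp [PPCInput.equalPointers]⟩

/-- The distribution of `(G¹, G²)` given `b`.  If `b = 0`, all matchings are uniform and
independent; if `b = 1`, they are so conditioned on equality of the two pointers. -/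
noncomputable def muPPCGiven (d w : ℕ) [NeZero w] (b : Bool) : PMF (PPCInput d w) :=
  if b then PMF.uniformOfFinset _ (PPCInput.equalPointers_nonempty d w)
  else PMF.uniformOfFintype (PPCInput d w)

/-- The joint distribution of the uniform bit `b` and the input `(G¹, G²)`. -/
noncomputable def muPPC (d w : ℕ) [NeZero w] : PMF (Bool × PPCInput d w) :=
  (PMF.uniformOfFintype Bool).bind fun b => (muPPCGiven d w b).map fun G => (b, G)

/-- A deterministic protocol for paired pointer chasing. -/
abbrev PPCProtocol (d w : ℕ) : Type := DetProtocol (AliceInput d w) (BobInput d w)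

/-- The probability that the protocol, run for `d - 2` rounds, outputs `b`. -/
noncomputable def PPCProtocol.successProb {d w : ℕ} [NeZero w] (π : PPCProtocol d w) : ℝ :=
  ((muPPC d w).toOuterMeasure
    {p | π.output (d - 2) (PPCInput.alice p.2) (PPCInput.bob p.2) = p.1}).toReal

/-! Two independent uniform pointers agree with probability 1/w, so `diagTest` is the density of the
case b = 0 minus that of b = 1. Hence the success probability is 1/2 plus half the average of
`diagTest` at the final pointers over the inputs answered `false` (`PPCProtocol.successProb_eq`),
and success 0.95 needs this average to be at least 0.9.

The player about to speak knows the current pair of pointers, but the matching that moves it belongs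
to the other player. Reveal that pair together with each message: the inputs compatible with a
history still carry a product weight A(x)B(y). Seen from a uniform pair a, the next pair is nearly
uniform under the listener's weight B, on average over a, unless B is tiny (`expect_gap_le`). The
reason is concentration for random permutations (`expect_exp_perm_le`): the average over a of the
relevant tests moves by O(1/w) under a transposition. The true pair is not uniform, but replacing
its law by the uniform one costs exactly the `gap` of the previous round, so the losses add up over
the rounds (`advantage_le`), from a gap that is zero before any message.

Small weights are handled by B·F ≤ exp(F - s) + (s - 1)·B with one fixed s. This is linear in B, so
over all histories the second term sums to (s - 1) times the total mass per round, while the first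
is multiplied by the number of histories, about (|msgs|·w²)^R. An s of order R(C + log w), C being
the cost, cancels that number, and λ of order w/d makes the advantage O(d³(C + log w)/w) plus a
small constant. -/

open scoped BigOperators

/-! ### Concentration on the symmetric group. -/

/-- Hoeffding's bound for a function of bounded oscillation on a finite type. -/
theorem expect_exp_sub_expect_le {ι : Type*} [Fintype ι] [Nonempty ι] (t : ι → ℝ) (L : ℝ)
    (h : ∀ i j, |t i - t j| ≤ L) :
    𝔼 i, Real.exp (t i - 𝔼 j, t j) ≤ Real.exp (L ^ 2 / 2) := by
  have hL : 0 ≤ L := (abs_nonneg _).trans (h (Classical.arbitrary ι) (Classical.arbitrary ι))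
  have hd : ∀ i, |t i - 𝔼 j, t j| ≤ L := fun i => by
    have : t i - 𝔼 j, t j = 𝔼 j, (t i - t j) := by
      rw [Finset.expect_sub_distrib, Fintype.expect_const]
    rw [this]
    refine (Finset.abs_expect_le _ _).trans ?_
    exact (Finset.expect_le_expect fun j _ => h i j).trans (by rw [Fintype.expect_const])
  rcases hL.eq_or_lt with rfl | hL
  · have : ∀ i, t i - 𝔼 j, t j = 0 := fun i => abs_nonpos_iff.mp (hd i)
    simp [this]
  have key : ∀ i, Real.exp (t i - 𝔼 j, t j)
      ≤ Real.cosh L + (t i - 𝔼 j, t j) * (Real.sinh L / L) := fun i => by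
    have := Real.exp_mul_le_cosh_add_mul_sinh (t := (t i - 𝔼 j, t j) / L)
      (by rw [abs_div, abs_of_pos hL]; exact (div_le_one hL).2 (hd i)) L
    rw [div_mul_cancel₀ _ hL.ne'] at this
    calc _ ≤ _ := this
      _ = _ := by ring
  calc 𝔼 i, Real.exp (t i - 𝔼 j, t j)
      ≤ 𝔼 i, (Real.cosh L + (t i - 𝔼 j, t j) * (Real.sinh L / L)) :=
        Finset.expect_le_expect fun i _ => key i
    _ = Real.cosh L := by
        rw [Finset.expect_add_distrib, ← Finset.expect_mul, Finset.expect_sub_distrib,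
          Fintype.expect_const, Fintype.expect_const, sub_self, zero_mul, add_zero]
    _ ≤ _ := Real.cosh_le_exp_half_sq L

theorem expect_perm_fin_succ {n : ℕ} (f : Equiv.Perm (Fin (n + 1)) → ℝ) :
    𝔼 σ, f σ = 𝔼 p : Fin (n + 1), 𝔼 e : Equiv.Perm (Fin n),
      f (Equiv.Perm.decomposeFin.symm (p, e)) := by
  rw [← Finset.expect_product', Finset.univ_product_univ]
  exact (Fintype.expect_equiv Equiv.Perm.decomposeFin.symm _ _ fun _ => rfl).symm

theorem decomposeFin_symm_mul_swap {n : ℕ} (p : Fin (n + 1)) (e : Equiv.Perm (Fin n))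
    (i j : Fin n) :
    Equiv.Perm.decomposeFin.symm (p, e * Equiv.swap i j)
      = Equiv.Perm.decomposeFin.symm (p, e) * Equiv.swap i.succ j.succ := by
  ext k
  refine Fin.cases ?_ (fun k => ?_) k
  · rw [Equiv.Perm.mul_apply, Equiv.swap_apply_of_ne_of_ne (Fin.succ_ne_zero i).symm
      (Fin.succ_ne_zero j).symm]
    simp
  · rw [Equiv.Perm.mul_apply, (Fin.succ_injective n).swap_apply]
    simp

/-- Fixing the image of `0` to be `q` rather than `p` changes the average of a function that is
Lipschitz for transpositions by at most its Lipschitz constant. -/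
theorem abs_expect_decomposeFin_sub_le {n : ℕ} (f : Equiv.Perm (Fin (n + 1)) → ℝ) (L : ℝ)
    (h : ∀ σ i j, |f (σ * Equiv.swap i j) - f σ| ≤ L) (p q : Fin (n + 1)) :
    |(𝔼 e, f (Equiv.Perm.decomposeFin.symm (p, e)))
      - 𝔼 e, f (Equiv.Perm.decomposeFin.symm (q, e))| ≤ L := by
  have key : ∀ (g : Equiv.Perm (Fin (n + 1)) → ℝ) (p : Fin (n + 1)),
      𝔼 e, g (Equiv.Perm.decomposeFin.symm (p, e))
        = (n + 1 : ℝ) * 𝔼 σ : Equiv.Perm (Fin (n + 1)), if σ 0 = p then g σ else 0 := by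
    intro g p
    rw [expect_perm_fin_succ]
    simp only [Equiv.Perm.decomposeFin_symm_apply_zero]
    have : ∀ x : Fin (n + 1), (𝔼 e : Equiv.Perm (Fin n),
        if x = p then g (Equiv.Perm.decomposeFin.symm (x, e)) else 0)
        = if x = p then 𝔼 e : Equiv.Perm (Fin n), g (Equiv.Perm.decomposeFin.symm (x, e))
          else 0 := by
      intro x; split_ifs <;> simp
    simp only [this]
    rw [Fintype.expect_eq_sum_div_card (ι := Fin (n + 1)), Finset.sum_ite_eq' Finset.univ p, if_pos (Finset.mem_univ p),
      Fintype.card_fin]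
    push_cast
    field_simp
  have swapped : 𝔼 e, f (Equiv.Perm.decomposeFin.symm (q, e))
      = 𝔼 e, f (Equiv.swap p q * Equiv.Perm.decomposeFin.symm (p, e)) := by
    rw [key f q, key (fun σ => f (Equiv.swap p q * σ)) p]
    congr 1
    refine (Fintype.expect_equiv (Equiv.mulLeft (Equiv.swap p q)) _ _ fun σ => ?_).symm
    have : (Equiv.swap p q) (σ 0) = q ↔ σ 0 = p := by
      rw [Equiv.swap_apply_eq_iff, Equiv.swap_apply_right]
    simp [this]
  rw [swapped, ← Finset.expect_sub_distrib]
  refine (Finset.abs_expect_le _ _).trans ?_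
  refine (Finset.expect_le_expect fun e _ => ?_).trans (Fintype.expect_const L).le
  set σ := Equiv.Perm.decomposeFin.symm (p, e)
  -- Left multiplication by `swap p q` couples the two conditional laws; it is also a right
  -- multiplication by a transposition, to which the Lipschitz hypothesis applies.
  have : Equiv.swap p q * σ = σ * Equiv.swap (σ⁻¹ p) (σ⁻¹ q) := by
    rw [Equiv.mul_swap_eq_swap_mul]; simp
  rw [this, abs_sub_comm]
  exact h _ _ _

/-- A function on permutations that is Lipschitz for transpositions is sub-Gaussian. -/
theorem expect_exp_perm_le : ∀ (n : ℕ) (f : Equiv.Perm (Fin n) → ℝ) (L : ℝ),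
    (∀ σ i j, |f (σ * Equiv.swap i j) - f σ| ≤ L) →
    𝔼 σ, Real.exp (f σ - 𝔼 τ, f τ) ≤ Real.exp (n * (L ^ 2 / 2))
  | 0, f, L, _ => by
    simp
  | n + 1, f, L, h => by
    set D := fun (p : Fin (n + 1)) (e : Equiv.Perm (Fin n)) =>
      Equiv.Perm.decomposeFin.symm (p, e) with hD
    set m := fun p => 𝔼 e, f (D p e) with hm
    have hmean : 𝔼 τ, f τ = 𝔼 p, m p := expect_perm_fin_succ f
    have inner : ∀ p, 𝔼 e, Real.exp (f (D p e) - m p) ≤ Real.exp (n * (L ^ 2 / 2)) := fun p =>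
      expect_exp_perm_le n (fun e => f (D p e)) L fun σ i j => by
        simp only [hD, decomposeFin_symm_mul_swap]; exact h _ _ _
    calc 𝔼 σ, Real.exp (f σ - 𝔼 τ, f τ)
        = 𝔼 p, 𝔼 e, Real.exp (f (D p e) - 𝔼 p, m p) := by
          rw [hmean, expect_perm_fin_succ]
      _ = 𝔼 p, Real.exp (m p - 𝔼 p, m p) * 𝔼 e, Real.exp (f (D p e) - m p) := by
          refine Finset.expect_congr rfl fun p _ => ?_
          rw [Finset.mul_expect]
          refine Finset.expect_congr rfl fun e _ => ?_
          rw [← Real.exp_add]; congr 1; ring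
      _ ≤ 𝔼 p, Real.exp (m p - 𝔼 p, m p) * Real.exp (n * (L ^ 2 / 2)) :=
          Finset.expect_le_expect fun p _ =>
            mul_le_mul_of_nonneg_left (inner p) (Real.exp_pos _).le
      _ ≤ Real.exp (L ^ 2 / 2) * Real.exp (n * (L ^ 2 / 2)) := by
          rw [← Finset.expect_mul]
          exact mul_le_mul_of_nonneg_right (expect_exp_sub_expect_le m L
            (abs_expect_decomposeFin_sub_le f L h)) (Real.exp_pos _).le
      _ = _ := by rw [← Real.exp_add]; congr 1; push_cast; ring

/-- Average out the second permutation first: the conditional mean inherits the Lipschitz constant,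
and each coordinate contributes n·L²/2. -/
theorem expect_exp_perm_prod_le {n : ℕ} (F : Equiv.Perm (Fin n) × Equiv.Perm (Fin n) → ℝ) (L : ℝ)
    (h₁ : ∀ σ τ i j, |F (σ * Equiv.swap i j, τ) - F (σ, τ)| ≤ L)
    (h₂ : ∀ σ τ i j, |F (σ, τ * Equiv.swap i j) - F (σ, τ)| ≤ L) (h0 : 𝔼 m, F m = 0) :
    𝔼 m, Real.exp (F m) ≤ Real.exp (n * L ^ 2) := by
  have split : ∀ g : Equiv.Perm (Fin n) × Equiv.Perm (Fin n) → ℝ,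
      𝔼 m, g m = 𝔼 σ, 𝔼 τ, g (σ, τ) := fun g => by
    rw [← Finset.expect_product', Finset.univ_product_univ]
  set G := fun σ => 𝔼 τ, F (σ, τ) with hG
  have hmean : 𝔼 σ, G σ = 0 := by rw [← h0, split]
  have hGL : ∀ σ i j, |G (σ * Equiv.swap i j) - G σ| ≤ L := fun σ i j => by
    rw [hG]; dsimp only
    rw [← Finset.expect_sub_distrib]
    exact (Finset.abs_expect_le _ _).trans
      ((Finset.expect_le_expect fun τ _ => h₁ σ τ i j).trans (Fintype.expect_const L).le)
  have outer := expect_exp_perm_le n G L hGL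
  simp only [hmean, sub_zero] at outer
  calc 𝔼 m, Real.exp (F m)
      = 𝔼 σ, Real.exp (G σ) * 𝔼 τ, Real.exp (F (σ, τ) - G σ) := by
        rw [split]
        refine Finset.expect_congr rfl fun σ _ => ?_
        rw [Finset.mul_expect]
        refine Finset.expect_congr rfl fun e _ => ?_
        rw [← Real.exp_add]; congr 1; ring
    _ ≤ 𝔼 σ, Real.exp (G σ) * Real.exp (n * (L ^ 2 / 2)) :=
        Finset.expect_le_expect fun σ _ => mul_le_mul_of_nonneg_left
          (expect_exp_perm_le n (fun τ => F (σ, τ)) L fun τ i j => h₂ σ τ i j) (Real.exp_pos _).le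
    _ ≤ Real.exp (n * (L ^ 2 / 2)) * Real.exp (n * (L ^ 2 / 2)) := by
        rw [← Finset.expect_mul]
        exact mul_le_mul_of_nonneg_right outer (Real.exp_pos _).le
    _ = _ := by rw [← Real.exp_add]; congr 1; ring

/-! ### Mean-zero tests of the next pair of pointers. -/

theorem expect_perm_apply {w : ℕ} [NeZero w] (ψ : Fin w → ℝ) (a : Fin w) :
    𝔼 σ : Equiv.Perm (Fin w), ψ (σ a) = 𝔼 v, ψ v := by
  have : ∀ b, 𝔼 σ : Equiv.Perm (Fin w), ψ (σ a) = 𝔼 σ : Equiv.Perm (Fin w), ψ (σ b) := fun b =>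
    Fintype.expect_equiv (Equiv.mulRight (Equiv.swap a b)) _ _ fun σ => by simp
  calc 𝔼 σ : Equiv.Perm (Fin w), ψ (σ a)
      = 𝔼 b : Fin w, 𝔼 σ : Equiv.Perm (Fin w), ψ (σ b) := by
        rw [← Finset.expect_congr rfl fun b _ => this b, Fintype.expect_const]
    _ = 𝔼 σ : Equiv.Perm (Fin w), 𝔼 b, ψ (σ b) := Finset.expect_comm _ _ _
    _ = 𝔼 σ : Equiv.Perm (Fin w), 𝔼 v, ψ v :=
        Finset.expect_congr rfl fun σ _ => Fintype.expect_equiv σ _ _ fun _ => rfl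
    _ = _ := Fintype.expect_const _

/-- The image of a pair of vertices under a pair of permutations. -/
def pairApply {w : ℕ} (m : Equiv.Perm (Fin w) × Equiv.Perm (Fin w)) (a : Fin w × Fin w) :
    Fin w × Fin w :=
  (m.1 a.1, m.2 a.2)

theorem expect_pairApply {w : ℕ} [NeZero w] (ψ : Fin w × Fin w → ℝ) (a : Fin w × Fin w) :
    𝔼 m, ψ (pairApply m a) = 𝔼 v, ψ v := by
  have split : ∀ (α : Type) [Fintype α] (g : α × α → ℝ),
      𝔼 m, g m = 𝔼 σ, 𝔼 τ, g (σ, τ) := fun α _ g => by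
    rw [← Finset.expect_product', Finset.univ_product_univ]
  rw [split, split]
  simp only [pairApply]
  rw [← expect_perm_apply (fun v => 𝔼 u, ψ (v, u)) a.1]
  exact Finset.expect_congr rfl fun σ _ => expect_perm_apply (fun u => ψ (σ a.1, u)) a.2

/-- Averaging over `Y` a function of `π` amounts to averaging over all pairs of permutations. -/
def UniformlyDistributed {Y : Type} [Fintype Y] {w : ℕ}
    (π : Y → Equiv.Perm (Fin w) × Equiv.Perm (Fin w)) : Prop :=
  ∀ F : Equiv.Perm (Fin w) × Equiv.Perm (Fin w) → ℝ, 𝔼 y, F (π y) = 𝔼 m, F m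

/-- A transposition affects only two of the w rows of pairs a. This gives the Lipschitz constant 2/w
for averages over a. -/
theorem abs_expect_row_change_le {w : ℕ} [NeZero w] (r : Fin w → Fin w → ℝ) (i j : Fin w)
    (h : ∀ k, |∑ l, r k l| ≤ w) (h0 : ∀ k, k ≠ i → k ≠ j → ∀ l, r k l = 0) :
    |𝔼 a : Fin w × Fin w, r a.1 a.2| ≤ 2 / w := by
  have hw : (0 : ℝ) < w := Nat.cast_pos.2 (NeZero.pos w)
  rw [Fintype.expect_eq_sum_div_card, abs_div, Fintype.sum_prod_type, Fintype.card_prod,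
    Fintype.card_fin]
  have : |∑ k, ∑ l, r k l| ≤ 2 * w := by
    calc |∑ k, ∑ l, r k l| ≤ ∑ k, |∑ l, r k l| := Finset.abs_sum_le_sum_abs _ _
      _ ≤ ∑ k, ((if k = i then (w : ℝ) else 0) + if k = j then (w : ℝ) else 0) := by
          refine Finset.sum_le_sum fun k _ => ?_
          have hk := h k
          by_cases hi : k = i
          · rw [if_pos hi]; split_ifs <;> linarith
          · by_cases hj : k = j
            · rw [if_neg hi, if_pos hj]; linarith
            · rw [Finset.sum_eq_zero fun l _ => h0 k hi hj l, if_neg hi, if_neg hj]; simp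
      _ = 2 * w := by rw [Finset.sum_add_distrib]; simp; ring
  push_cast
  rw [abs_of_pos (by positivity : (0 : ℝ) < w * w), div_le_div_iff₀ (by positivity) hw]
  nlinarith

/-- If `φ a` has mean zero for each pair `a` and its row and column sums are stable, then the
average of `φ a (π y a)` over all `a` and over the `y` of weight `B` is small unless `B` is. -/
theorem expect_test_le {Y : Type} [Fintype Y] [Nonempty Y] {w : ℕ} [NeZero w]
    (π : Y → Equiv.Perm (Fin w) × Equiv.Perm (Fin w)) (hπ : UniformlyDistributed π)
    (B : Y → ℝ) (hB : ∀ y, B y ∈ Set.Icc (0 : ℝ) 1)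
    (φ : Fin w × Fin w → Fin w × Fin w → ℝ) (hφ : ∀ a, 𝔼 v, φ a v = 0)
    (hrow : ∀ i c c' (τ : Equiv.Perm (Fin w)),
      |∑ j, (φ (i, j) (c, τ j) - φ (i, j) (c', τ j))| ≤ w)
    (hcol : ∀ j c c' (σ : Equiv.Perm (Fin w)),
      |∑ i, (φ (i, j) (σ i, c) - φ (i, j) (σ i, c'))| ≤ w)
    (lam s : ℝ) (hlam : 0 < lam) :
    𝔼 a, 𝔼 y, B y * φ a (pairApply (π y) a)
      ≤ (Real.exp (-s) * Real.exp (4 * lam ^ 2 / w) + (s - 1) * 𝔼 y, B y) / lam := by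
  have hw : (0 : ℝ) < w := Nat.cast_pos.2 (NeZero.pos w)
  set F : Equiv.Perm (Fin w) × Equiv.Perm (Fin w) → ℝ := fun m =>
    lam * 𝔼 a, φ a (pairApply m a) with hF
  have h0 : 𝔼 m, F m = 0 := by
    simp only [hF]
    rw [← Finset.mul_expect, Finset.expect_comm]
    rw [Finset.expect_congr rfl fun a _ => (expect_pairApply (φ a) a).trans (hφ a)]
    simp
  have hdiff : ∀ m m', F m - F m'
      = lam * 𝔼 a : Fin w × Fin w, (φ a (pairApply m a) - φ a (pairApply m' a)) := by
    intro m m'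
    rw [Finset.expect_sub_distrib, hF]; ring
  have mgf : 𝔼 m, Real.exp (F m) ≤ Real.exp (4 * lam ^ 2 / w) := by
    refine (expect_exp_perm_prod_le F (lam * (2 / w)) ?_ ?_ h0).trans_eq ?_
    · intro σ τ i j
      rw [hdiff, abs_mul, abs_of_pos hlam]
      refine mul_le_mul_of_nonneg_left ?_ hlam.le
      refine abs_expect_row_change_le (fun k l => φ (k, l) (pairApply (σ * Equiv.swap i j, τ) (k, l))
        - φ (k, l) (pairApply (σ, τ) (k, l))) i j (fun k => hrow k ((σ * Equiv.swap i j) k) (σ k) τ) ?_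
      intro k hi hj l
      simp [pairApply, Equiv.swap_apply_of_ne_of_ne hi hj]
    · intro σ τ i j
      rw [hdiff, abs_mul, abs_of_pos hlam]
      refine mul_le_mul_of_nonneg_left ?_ hlam.le
      have := abs_expect_row_change_le
        (fun l k => φ (k, l) (pairApply (σ, τ * Equiv.swap i j) (k, l))
        - φ (k, l) (pairApply (σ, τ) (k, l))) i j 
        (fun l => hcol l ((τ * Equiv.swap i j) l) (τ l) σ) (by
          intro k hi hj l
          simp [pairApply, Equiv.swap_apply_of_ne_of_ne hi hj])
      refine (congrArg abs ?_).trans_le this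
      exact Fintype.expect_equiv (Equiv.prodComm (Fin w) (Fin w)) _ _ fun _ => rfl
    · congr 1; field_simp; norm_num
  rw [le_div_iff₀ hlam]
  calc (𝔼 a, 𝔼 y, B y * φ a (pairApply (π y) a)) * lam
      = 𝔼 y, B y * F (π y) := by
        rw [Finset.expect_comm, Finset.expect_mul]
        refine Finset.expect_congr rfl fun y _ => ?_
        simp only [hF]
        rw [← Finset.mul_expect]; ring
    _ ≤ 𝔼 y, (Real.exp (-s) * Real.exp (F (π y)) + (s - 1) * B y) := by
        refine Finset.expect_le_expect fun y _ => ?_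
        obtain ⟨h0, h1⟩ := hB y
        -- F - s + 1 ≤ exp(F - s), multiplied by B ∈ [0, 1]: a linearised entropy inequality.
        have e1 := Real.add_one_le_exp (F (π y) - s)
        have e2 : Real.exp (F (π y) - s) = Real.exp (-s) * Real.exp (F (π y)) := by
          rw [← Real.exp_add]; congr 1; ring
        have e3 := Real.exp_pos (F (π y) - s)
        rw [← e2]
        nlinarith
    _ = Real.exp (-s) * (𝔼 m, Real.exp (F m)) + (s - 1) * 𝔼 y, B y := by
        rw [Finset.expect_add_distrib, ← Finset.mul_expect, ← Finset.mul_expect,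
          hπ fun m => Real.exp (F m)]
    _ ≤ _ := by gcongr

/-! ### The gap between the next pair of pointers and a uniform one. -/

/-- The function `1 - w · [v₁ = v₂]` of a pair `v` of vertices. -/
def diagTest {w : ℕ} (v : Fin w × Fin w) : ℝ := 1 - if v.1 = v.2 then (w : ℝ) else 0

theorem expect_diagTest {w : ℕ} [NeZero w] : 𝔼 v : Fin w × Fin w, diagTest v = 0 := by
  have hw : (w : ℝ) ≠ 0 := Nat.cast_ne_zero.2 (NeZero.ne w)
  unfold diagTest
  rw [Finset.expect_sub_distrib, Fintype.expect_const, Fintype.expect_eq_sum_div_card,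
    Fintype.sum_prod_type]
  simp
  field_simp
  simp

theorem expect_indicator_sub {w : ℕ} [NeZero w] (b : Fin w × Fin w) :
    𝔼 v : Fin w × Fin w, ((if v = b then (1 : ℝ) else 0) - 1 / (w : ℝ) ^ 2) = 0 := by
  have hw : (w : ℝ) ≠ 0 := Nat.cast_ne_zero.2 (NeZero.ne w)
  rw [Finset.expect_sub_distrib, Fintype.expect_const, Fintype.expect_eq_sum_div_card]
  simp
  field_simp
  simp

/-- How far the pair reached from `a` by `m R` is from uniform under the weight `B`: for `R = 0`
only the deficit of equal pairs counts, for `R > 0` the total variation distance. -/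
noncomputable def gap {Y : Type} [Fintype Y] {w : ℕ} (B : Y → ℝ)
    (m : ℕ → Y → Equiv.Perm (Fin w) × Equiv.Perm (Fin w)) : ℕ → Fin w × Fin w → ℝ
  | 0, a => max 0 (𝔼 y, B y * diagTest (pairApply (m 0 y) a))
  | R + 1, a => ∑ b, max 0 (𝔼 y, B y *
      ((if pairApply (m (R + 1) y) a = b then (1 : ℝ) else 0) - 1 / (w : ℝ) ^ 2))

section gap

variable {Y : Type} [Fintype Y] {w : ℕ} (B : Y → ℝ)
  (m : ℕ → Y → Equiv.Perm (Fin w) × Equiv.Perm (Fin w))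

theorem gap_nonneg : ∀ (R : ℕ) (a : Fin w × Fin w), 0 ≤ gap B m R a
  | 0, _ => le_max_left _ _
  | _ + 1, _ => Finset.sum_nonneg fun _ _ => le_max_left _ _

theorem gap_le [NeZero w] (hB : ∀ y, 0 ≤ B y) (R : ℕ) (a : Fin w × Fin w) :
    gap B m R a ≤ 𝔼 y, B y := by
  cases R with
  | zero =>
    refine max_le (Finset.expect_nonneg fun y _ => hB y) (Finset.expect_le_expect fun y _ => ?_)
    refine mul_le_of_le_one_right (hB y) ?_
    unfold diagTest
    split_ifs <;> simp
  | succ R =>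
    calc gap B m (R + 1) a
        ≤ ∑ b, 𝔼 y, B y * (if pairApply (m (R + 1) y) a = b then (1 : ℝ) else 0) := by
          refine Finset.sum_le_sum fun b _ => max_le ?_ (Finset.expect_le_expect fun y _ => ?_)
          · exact Finset.expect_nonneg fun y _ => mul_nonneg (hB y) (by split_ifs <;> simp)
          · exact mul_le_mul_of_nonneg_left (sub_le_self _ (by positivity)) (hB y)
      _ = 𝔼 y, B y := by
          rw [← Finset.expect_sum_comm]
          refine Finset.expect_congr rfl fun y _ => ?_
          rw [← Finset.mul_sum]; simp

/-- The starting point of the induction: before any message the first step is exactly uniform. -/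
theorem gap_one_eq_zero [NeZero w] (R : ℕ) (hm : UniformlyDistributed (m R)) (a : Fin w × Fin w) :
    gap (fun _ => 1) m R a = 0 := by
  cases R with
  | zero =>
    simp only [gap, one_mul]
    rw [hm fun μ => diagTest (pairApply μ a), expect_pairApply, expect_diagTest, max_self]
  | succ R =>
    simp only [gap, one_mul]
    refine Finset.sum_eq_zero fun b _ => ?_
    rw [hm fun μ => (if pairApply μ a = b then (1 : ℝ) else 0) - 1 / (w : ℝ) ^ 2,
      expect_pairApply fun v => (if v = b then (1 : ℝ) else 0) - 1 / (w : ℝ) ^ 2,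
      expect_indicator_sub, max_self]

theorem max_zero_eq_indicator_mul (t : ℝ) : max 0 t = (if 0 < t then 1 else 0) * t := by
  split_ifs with h
  · rw [one_mul, max_eq_right h.le]
  · rw [zero_mul, max_eq_left (not_lt.1 h)]

/-- A positive part is the signed average times an indicator χ of its sign, so the gap is itself a
test for `expect_test_le`. For R = 0 the spike of height w on the diagonal is harmless, since a
permutation meets it once in each row or column; for R > 0 each entry changes by at most 1. -/
theorem expect_gap_le [Nonempty Y] [NeZero w] (hB : ∀ y, B y ∈ Set.Icc (0 : ℝ) 1) (R : ℕ)
    (hm : UniformlyDistributed (m R)) (lam s : ℝ) (hlam : 0 < lam) :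
    𝔼 a, gap B m R a
      ≤ (Real.exp (-s) * Real.exp (4 * lam ^ 2 / w) + (s - 1) * 𝔼 y, B y) / lam := by
  have hind : ∀ t t' : ℝ, |(if 0 < t then (1 : ℝ) else 0) - if 0 < t' then 1 else 0| ≤ 1 := by
    intro t t'; split_ifs <;> simp
  cases R with
  | zero =>
    set χ : Fin w × Fin w → ℝ := fun a =>
      if 0 < 𝔼 y, B y * diagTest (pairApply (m 0 y) a) then 1 else 0 with hχ
    have collapse : ∀ (x : Fin w → ℝ) (k : Fin w) (τ : Equiv.Perm (Fin w)),
        ∑ j, x j * (if k = τ j then (w : ℝ) else 0) = x (τ.symm k) * w := by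
      intro x k τ
      rw [Finset.sum_eq_single (τ.symm k)]
      · simp
      · intro b _ hb
        rw [if_neg (fun h => hb (by rw [h]; simp)), mul_zero]
      · simp
    have bound : ∀ a b, |χ a * (w : ℝ) - χ b * w| ≤ w := fun a b => by
      rw [← sub_mul, abs_mul, Nat.abs_cast]
      exact mul_le_of_le_one_left (Nat.cast_nonneg _) (hind _ _)
    have := expect_test_le (m 0) hm B hB (fun a v => χ a * diagTest v)
      (fun a => by rw [← Finset.mul_expect, expect_diagTest, mul_zero])
      (fun i c c' τ => by
        have : ∑ j, (χ (i, j) * diagTest (c, τ j) - χ (i, j) * diagTest (c', τ j))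
            = χ (i, τ.symm c') * w - χ (i, τ.symm c) * w := by
          rw [← collapse (fun j => χ (i, j)), ← collapse (fun j => χ (i, j)),
            ← Finset.sum_sub_distrib]
          refine Finset.sum_congr rfl fun j _ => ?_
          simp only [diagTest]; ring
        rw [this]; exact bound _ _)
      (fun i c c' τ => by
        have : ∑ j, (χ (j, i) * diagTest (τ j, c) - χ (j, i) * diagTest (τ j, c'))
            = χ (τ.symm c', i) * w - χ (τ.symm c, i) * w := by
          rw [← collapse (fun j => χ (j, i)), ← collapse (fun j => χ (j, i)),
            ← Finset.sum_sub_distrib]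
          refine Finset.sum_congr rfl fun j _ => ?_
          simp only [diagTest, eq_comm (a := τ j)]; ring
        rw [this]; exact bound _ _) lam s hlam
    refine le_trans (le_of_eq ?_) this
    refine Finset.expect_congr rfl fun a _ => ?_
    rw [gap, max_zero_eq_indicator_mul, Finset.mul_expect]
    exact Finset.expect_congr rfl fun y _ => by ring
  | succ R =>
    set χ : Fin w × Fin w → Fin w × Fin w → ℝ := fun a b =>
      if 0 < 𝔼 y, B y *
        ((if pairApply (m (R + 1) y) a = b then (1 : ℝ) else 0) - 1 / (w : ℝ) ^ 2) then 1 else 0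
      with hχ
    set φ : Fin w × Fin w → Fin w × Fin w → ℝ := fun a v =>
      ∑ b, χ a b * ((if v = b then (1 : ℝ) else 0) - 1 / (w : ℝ) ^ 2) with hφ
    have diff : ∀ a v v', φ a v - φ a v' = χ a v - χ a v' := by
      intro a v v'
      have : ∀ v, φ a v = χ a v - ∑ b, χ a b * (1 / (w : ℝ) ^ 2) := fun v => by
        simp only [hφ, mul_sub, Finset.sum_sub_distrib]; simp
      rw [this, this]; ring
    have sum_le : ∀ x : Fin w → ℝ, (∀ j, |x j| ≤ 1) → |∑ j, x j| ≤ w := fun x hx =>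
      (Finset.abs_sum_le_sum_abs _ _).trans
        ((Finset.sum_le_sum fun j _ => hx j).trans (by simp))
    have := expect_test_le (m (R + 1)) hm B hB φ
      (fun a => by
        simp only [hφ]
        rw [Finset.expect_sum_comm]
        refine Finset.sum_eq_zero fun b _ => ?_
        rw [← Finset.mul_expect, expect_indicator_sub, mul_zero])
      (fun i c c' τ => sum_le _ fun j => by rw [diff]; exact hind _ _)
      (fun i c c' τ => sum_le _ fun j => by rw [diff]; exact hind _ _) lam s hlam
    refine le_trans (le_of_eq ?_) this
    refine Finset.expect_congr rfl fun a _ => ?_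
    simp only [gap, hφ, Finset.mul_sum]
    rw [Finset.expect_sum_comm]
    refine Finset.sum_congr rfl fun b _ => ?_
    rw [max_zero_eq_indicator_mul, Finset.mul_expect]
    exact Finset.expect_congr rfl fun y _ => by ring

end gap

/-! ### Induction over the rounds. -/

/-- The answer after `R` further rounds following the messages `t`, when the player with message
function `f` and answer function `o` is the next to speak. -/
def play {α : Type} : ℕ → (List α → α) → (List α → Bool) → (List α → α) → (List α → Bool) →
    List α → Bool
  | 0, _, o, _, _, t => o t
  | R + 1, f, o, g, o', t => play R g o' f o (t ++ [f t])

/-- Follow `mY R`, `mX (R - 1)`, `mY (R - 2)`, … down to index `0`. -/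
def chase {w : ℕ} : ℕ → (ℕ → Equiv.Perm (Fin w) × Equiv.Perm (Fin w)) →
    (ℕ → Equiv.Perm (Fin w) × Equiv.Perm (Fin w)) → Fin w × Fin w → Fin w × Fin w
  | 0, _, mY, a => pairApply (mY 0) a
  | R + 1, mX, mY, a => chase R mY mX (pairApply (mY (R + 1)) a)

/-- The indicator of the answer `false`. -/
def rejects (b : Bool) : ℝ := if b then 0 else 1

/-- The average of `diagTest` at the final pair of pointers over the inputs, weighted by `A` and
`B`, on which the answer is `false`. -/
noncomputable def advantage {X Y α : Type} [Fintype X] [Fintype Y] {w : ℕ} (R : ℕ)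
    (f : X → List α → α) (o : X → List α → Bool) (g : Y → List α → α) (o' : Y → List α → Bool)
    (mX : ℕ → X → Equiv.Perm (Fin w) × Equiv.Perm (Fin w))
    (mY : ℕ → Y → Equiv.Perm (Fin w) × Equiv.Perm (Fin w))
    (A : X → ℝ) (B : Y → ℝ) (t : List α) (p : X → Fin w × Fin w) : ℝ :=
  𝔼 x, 𝔼 y, A x * B y * (rejects (play R (f x) (o x) (g y) (o' y) t) *
    diagTest (chase R (fun i => mX i x) (fun i => mY i y) (p x)))

section

variable {X Y α : Type} [Fintype X] [Fintype Y] [DecidableEq α] {w : ℕ}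

/-- The pair a and the message μ are both functions of x, so fixing them only cuts down A and leaves
a product weight. Once a is fixed, the next pair is a function of y, and the roles can be exchanged.
-/
theorem advantage_succ (R : ℕ)
    (f : X → List α → α) (o : X → List α → Bool) (g : Y → List α → α) (o' : Y → List α → Bool)
    (mX : ℕ → X → Equiv.Perm (Fin w) × Equiv.Perm (Fin w))
    (mY : ℕ → Y → Equiv.Perm (Fin w) × Equiv.Perm (Fin w))
    (A : X → ℝ) (B : Y → ℝ) (t : List α) (p : X → Fin w × Fin w)
    (msgs : Finset α) (hf : ∀ x t, f x t ∈ msgs) :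
    advantage (R + 1) f o g o' mX mY A B t p
      = ∑ a, ∑ μ ∈ msgs, advantage R g o' f o mY mX B
          (fun x => if p x = a ∧ f x t = μ then A x else 0) (t ++ [μ])
          (fun y => pairApply (mY (R + 1) y) a) := by
  unfold advantage
  simp only [← Finset.expect_sum_comm]
  rw [Finset.expect_comm]
  refine Finset.expect_congr rfl fun y _ => Finset.expect_congr rfl fun x _ => ?_
  rw [Finset.sum_eq_single (p x), Finset.sum_eq_single (f x t)]
  · simp only [and_self, if_true, play, chase]; ring
  · intro μ _ hμ
    rw [if_neg (fun h => hμ h.2.symm)]; ring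
  · exact fun h => absurd (hf x t) h
  · intro a _ ha
    refine Finset.sum_eq_zero fun μ _ => ?_
    rw [if_neg (fun h => ha h.1.symm)]; ring
  · simp

theorem sum_expect_fiber (p : X → Fin w × Fin w) (A : X → ℝ) (h : X → α) (msgs : Finset α)
    (hh : ∀ x, h x ∈ msgs) (a : Fin w × Fin w) :
    ∑ μ ∈ msgs, 𝔼 x, (if p x = a ∧ h x = μ then A x else 0)
      = 𝔼 x, if p x = a then A x else 0 := by
  rw [← Finset.expect_sum_comm]
  refine Finset.expect_congr rfl fun x _ => ?_
  by_cases hp : p x = a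
  · simp [hp, hh x]
  · simp [hp]

theorem sum_expect_image (p : X → Fin w × Fin w) (A : X → ℝ) :
    ∑ a, 𝔼 x, (if p x = a then A x else 0) = 𝔼 x, A x := by
  rw [← Finset.expect_sum_comm]
  exact Finset.expect_congr rfl fun x _ => by simp

/-- The law of the next pair exceeds the uniform one by the gap in total, and on this excess g is at
most G. -/
theorem sum_image_mul_le [NeZero w] (R : ℕ) (B : Y → ℝ)
    (mY : ℕ → Y → Equiv.Perm (Fin w) × Equiv.Perm (Fin w)) (a : Fin w × Fin w)
    (g : Fin w × Fin w → ℝ) (G : ℝ) (hg0 : ∀ b, 0 ≤ g b) (hgG : ∀ b, g b ≤ G) :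
    ∑ b, (𝔼 y, if pairApply (mY (R + 1) y) a = b then B y else 0) * g b
      ≤ gap B mY (R + 1) a * G + (𝔼 y, B y) * 𝔼 b, g b := by
  have hw : (w : ℝ) ≠ 0 := Nat.cast_ne_zero.2 (NeZero.ne w)
  have e : ∀ b, 𝔼 y, (if pairApply (mY (R + 1) y) a = b then B y else 0)
      = 𝔼 y, B y * ((if pairApply (mY (R + 1) y) a = b then (1 : ℝ) else 0) - 1 / (w : ℝ) ^ 2)
        + (𝔼 y, B y) * (1 / (w : ℝ) ^ 2) := fun b => by
    rw [Finset.expect_mul, ← Finset.expect_add_distrib]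
    refine Finset.expect_congr rfl fun y _ => ?_
    split_ifs <;> ring
  have hexp : 𝔼 b, g b = ∑ b, 1 / (w : ℝ) ^ 2 * g b := by
    rw [Fintype.expect_eq_sum_div_card, ← Finset.mul_sum]
    simp
    field_simp
  rw [hexp, gap, Finset.sum_mul, Finset.mul_sum, ← Finset.sum_add_distrib]
  refine Finset.sum_le_sum fun b _ => ?_
  rw [e, add_mul]
  refine add_le_add ?_ (le_of_eq (by ring))
  exact (mul_le_mul_of_nonneg_right (le_max_right 0 _) (hg0 b)).trans
    (mul_le_mul_of_nonneg_left (hgG b) (le_max_left _ _))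

end

/-- The advantage is bounded by the gap for the next pointer, averaged over the known one, plus a
loss in each round. -/
theorem advantage_le {α : Type} [DecidableEq α] {w : ℕ} [NeZero w] (msgs : Finset α)
    (hmsgs : msgs.Nonempty) (lam s : ℝ) (hlam : 0 < lam) :
    ∀ (R : ℕ) {X Y : Type} [Fintype X] [Fintype Y] [Nonempty X] [Nonempty Y]
    (f : X → List α → α) (o : X → List α → Bool) (g : Y → List α → α) (o' : Y → List α → Bool)
    (mX : ℕ → X → Equiv.Perm (Fin w) × Equiv.Perm (Fin w))
    (mY : ℕ → Y → Equiv.Perm (Fin w) × Equiv.Perm (Fin w))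
    (A : X → ℝ) (B : Y → ℝ) (t : List α) (p : X → Fin w × Fin w),
    (∀ x t, f x t ∈ msgs) → (∀ y t, g y t ∈ msgs) →
    (∀ i ≤ R, Odd (R + i) → UniformlyDistributed (mX i)) →
    (∀ i ≤ R, Even (R + i) → UniformlyDistributed (mY i)) →
    (∀ x, A x ∈ Set.Icc (0 : ℝ) 1) → (∀ y, B y ∈ Set.Icc (0 : ℝ) 1) →
    advantage R f o g o' mX mY A B t p
      ≤ ∑ a, (𝔼 x, if p x = a then A x else 0) * gap B mY R a
        + ((s - 1) * R * ((𝔼 x, A x) * 𝔼 y, B y)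
          + Real.exp (-s) * Real.exp (4 * lam ^ 2 / w)
            * (R * ((msgs.card : ℝ) * (w : ℝ) ^ 2) ^ R * (𝔼 x, A x + 𝔼 y, B y))) / lam := by
  intro R
  induction R with
  | zero =>
    intro X Y _ _ _ _ f o g o' mX mY A B t p _ _ _ _ hA _
    have : ∑ a, (𝔼 x, if p x = a then A x else 0) * gap B mY 0 a
        = 𝔼 x, A x * gap B mY 0 (p x) := by
      simp only [Finset.expect_mul]
      rw [← Finset.expect_sum_comm]
      exact Finset.expect_congr rfl fun x _ => by simp [ite_mul]
    rw [this]
    simp only [Nat.cast_zero, mul_zero, zero_mul, add_zero, zero_div]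
    refine Finset.expect_le_expect fun x _ => ?_
    -- With no message left the answer depends on x alone, hence only keeps or kills the average
    -- over y.
    have e : 𝔼 y, A x * B y * (rejects (play 0 (f x) (o x) (g y) (o' y) t) *
        diagTest (chase 0 (fun i => mX i x) (fun i => mY i y) (p x)))
        = A x * (rejects (o x t) * 𝔼 y, B y * diagTest (pairApply (mY 0 y) (p x))) := by
      rw [Finset.mul_expect, Finset.mul_expect]
      refine Finset.expect_congr rfl fun y _ => ?_
      simp only [play, chase]; ring
    rw [e]
    refine mul_le_mul_of_nonneg_left ?_ (hA x).1
    rw [gap, rejects]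
    split_ifs
    · rw [zero_mul]; exact le_max_left _ _
    · rw [one_mul]; exact le_max_right _ _
  | succ R ih =>
    intro X Y _ _ _ _ f o g o' mX mY A B t p hf hg hmX hmY hA hB
    set Q : ℝ := (msgs.card : ℝ) * (w : ℝ) ^ 2 with hQ
    set K : ℝ := Real.exp (-s) * Real.exp (4 * lam ^ 2 / w) with hK
    have hK0 : 0 ≤ K := by positivity
    have hQ1 : 1 ≤ Q := by
      have h1 : (1 : ℝ) ≤ msgs.card := by exact_mod_cast hmsgs.card_pos
      have h2 : (1 : ℝ) ≤ w := by exact_mod_cast NeZero.pos w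
      exact one_le_mul_of_one_le_of_one_le h1 (one_le_pow₀ h2)
    set A' : Fin w × Fin w → α → X → ℝ := fun a μ x =>
      if p x = a ∧ f x t = μ then A x else 0 with hA'
    have hA'mem : ∀ a μ x, A' a μ x ∈ Set.Icc (0 : ℝ) 1 := fun a μ x => by
      simp only [hA']; split_ifs
      · exact hA x
      · simp
    set EB := 𝔼 y, B y with hEB
    have hEB0 : 0 ≤ EB := Finset.expect_nonneg fun y _ => (hB y).1
    have hEA0 : 0 ≤ 𝔼 x, A x := Finset.expect_nonneg fun x _ => (hA x).1
    -- The induction hypothesis with roles exchanged (`h1`), then a uniform pair in place of the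
    -- true one (`h2`), then concentration for the average gap (`h3`).
    have child : ∀ a, ∀ μ ∈ msgs, advantage R g o' f o mY mX B (A' a μ) (t ++ [μ])
          (fun y => pairApply (mY (R + 1) y) a)
        ≤ gap B mY (R + 1) a * (𝔼 x, A' a μ x)
          + (EB * K + (s - 1) * (R + 1) * EB * (𝔼 x, A' a μ x)
            + K * (R * Q ^ R * (EB + 𝔼 x, A' a μ x))) / lam := by
      intro a μ _
      have h1 := ih g o' f o mY mX B (A' a μ) (t ++ [μ]) (fun y => pairApply (mY (R + 1) y) a)
        hg hf (fun i hi h => hmY i (by omega) (by grind)) (fun i hi h => hmX i (by omega) (by grind))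
        hB (hA'mem a μ)
      have h2 := sum_image_mul_le R B mY a (gap (A' a μ) mX R) (𝔼 x, A' a μ x)
        (gap_nonneg _ _ _) (gap_le _ _ (fun x => (hA'mem a μ x).1) R)
      have h3 := mul_le_mul_of_nonneg_left (expect_gap_le (A' a μ) mX (hA'mem a μ) R
        (hmX R (by omega) (by grind)) lam s hlam) hEB0
      refine h1.trans ((add_le_add_left (h2.trans (add_le_add_right h3 _)) _).trans_eq ?_)
      ring
    have fiber : ∑ a, ∑ μ ∈ msgs, 𝔼 x, A' a μ x = 𝔼 x, A x := by
      rw [← sum_expect_image p A]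
      exact Finset.sum_congr rfl fun a _ => sum_expect_fiber p A (fun x => f x t) msgs
        (fun x => hf x t) a
    -- Terms proportional to the mass of `A'` sum to the mass of A (`fiber`); only the terms without
    -- it, which carry exp(-s), pay the factor Q.
    have const : ∀ c : ℝ, ∑ _a : Fin w × Fin w, ∑ _μ ∈ msgs, c = Q * c := fun c => by
      simp [hQ]; ring
    rw [advantage_succ R f o g o' mX mY A B t p msgs hf]
    calc ∑ a, ∑ μ ∈ msgs, advantage R g o' f o mY mX B (A' a μ) (t ++ [μ])
          (fun y => pairApply (mY (R + 1) y) a)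
        ≤ ∑ a, ∑ μ ∈ msgs, (gap B mY (R + 1) a * (𝔼 x, A' a μ x)
          + (((s - 1) * (R + 1) * EB + K * (R * Q ^ R)) / lam * (𝔼 x, A' a μ x)
            + (EB * K + K * (R * Q ^ R * EB)) / lam)) := by
          refine Finset.sum_le_sum fun a _ => Finset.sum_le_sum fun μ hμ => ?_
          refine (child a μ hμ).trans_eq ?_
          ring
      _ = ∑ a, (𝔼 x, if p x = a then A x else 0) * gap B mY (R + 1) a
          + (((s - 1) * (R + 1) * EB + K * (R * Q ^ R)) / lam * (𝔼 x, A x)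
            + Q * ((EB * K + K * (R * Q ^ R * EB)) / lam)) := by
          simp only [Finset.sum_add_distrib, ← Finset.mul_sum, const, fiber]
          congr 1
          refine Finset.sum_congr rfl fun a _ => ?_
          rw [sum_expect_fiber p A (fun x => f x t) msgs (fun x => hf x t) a, mul_comm]
      _ ≤ _ := by
          refine add_le_add_right ?_ _
          rw [div_mul_eq_mul_div, mul_div_assoc', ← add_div]
          refine div_le_div_of_nonneg_right ?_ hlam.le
          have hQR : 1 ≤ Q ^ R := one_le_pow₀ hQ1
          push_cast
          rw [pow_succ]
          have k1 : EB * Q ≤ EB * (Q ^ R * Q) := by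
            refine mul_le_mul_of_nonneg_left ?_ hEB0
            nlinarith
          have k2 : R * Q ^ R * (𝔼 x, A x) ≤ (R + 1) * (Q ^ R * Q) * (𝔼 x, A x) := by
            refine mul_le_mul_of_nonneg_right ?_ hEA0
            have : Q ^ R ≤ Q ^ R * Q := le_mul_of_one_le_right (by positivity) hQ1
            have hR : (0 : ℝ) ≤ R := Nat.cast_nonneg R
            nlinarith
          have := mul_le_mul_of_nonneg_left (add_le_add k1 k2) hK0
          nlinarith

/-! ### Uniform inputs, and layered graphs as chases. -/

theorem expect_pi_apply {ι G : Type*} [Fintype ι] [DecidableEq ι] [Fintype G] [Group G]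
    (k : ι) (F : G → ℝ) : 𝔼 z : ι → G, F (z k) = 𝔼 m, F m := by
  have h : ∀ m : G, 𝔼 z : ι → G, F (z k) = 𝔼 z : ι → G, F (z k * m) := fun m =>
    (Fintype.expect_equiv (Equiv.mulRight (Pi.mulSingle k m)) _ _ fun z => by simp).symm
  calc 𝔼 z : ι → G, F (z k) = 𝔼 m : G, 𝔼 z : ι → G, F (z k * m) := by
        rw [← Finset.expect_congr rfl fun m _ => h m, Fintype.expect_const]
    _ = 𝔼 z : ι → G, 𝔼 m : G, F (z k * m) := Finset.expect_comm _ _ _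
    _ = 𝔼 z : ι → G, 𝔼 m : G, F m := Finset.expect_congr rfl fun z _ =>
        Fintype.expect_equiv (Equiv.mulLeft (z k)) _ _ fun _ => rfl
    _ = _ := Fintype.expect_const _

/-- Composing the last matching with any σ preserves the uniform law; averaging over σ makes the
endpoint uniform. -/
theorem expect_point {n w : ℕ} [NeZero w] (ψ : Fin w → ℝ) (v : Fin w) :
    𝔼 G : LayeredGraph (n + 2) w, ψ (G.point v) = 𝔼 u, ψ u := by
  have h : ∀ σ : Equiv.Perm (Fin w), 𝔼 G : LayeredGraph (n + 2) w, ψ (G.point v)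
      = 𝔼 G : LayeredGraph (n + 2) w, ψ (σ (G.point v)) := fun σ => by
    refine (Fintype.expect_equiv
      (Equiv.mulLeft (Pi.mulSingle (Fin.last n) σ : LayeredGraph (n + 2) w)) _ _ fun G => ?_).symm
    congr 1
    change σ (Fin.foldl (n + 1) _ v) = Fin.foldl (n + 1) _ v
    rw [Fin.foldl_succ_last, Fin.foldl_succ_last]
    simp [Fin.castSucc_ne_last]
  calc 𝔼 G : LayeredGraph (n + 2) w, ψ (G.point v)
      = 𝔼 σ : Equiv.Perm (Fin w), 𝔼 G : LayeredGraph (n + 2) w, ψ (σ (G.point v)) := by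
        rw [← Finset.expect_congr rfl fun σ _ => h σ, Fintype.expect_const]
    _ = 𝔼 G : LayeredGraph (n + 2) w, 𝔼 σ : Equiv.Perm (Fin w), ψ (σ (G.point v)) :=
        Finset.expect_comm _ _ _
    _ = 𝔼 G : LayeredGraph (n + 2) w, 𝔼 u, ψ u :=
        Finset.expect_congr rfl fun G _ => expect_perm_apply ψ _
    _ = _ := Fintype.expect_const _

theorem expect_points {n w : ℕ} [NeZero w] (ψ : Fin w × Fin w → ℝ) (v : Fin w) :
    𝔼 G : PPCInput (n + 2) w, ψ (G.1.point v, G.2.point v) = 𝔼 u, ψ u := by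
  rw [← Finset.univ_product_univ, ← Finset.univ_product_univ, Finset.expect_product,
    Finset.expect_product]
  simp only
  rw [← expect_point (n := n) (fun u => 𝔼 u', ψ (u, u')) v]
  exact Finset.expect_congr rfl fun G _ => expect_point (fun u' => ψ (G.point v, u')) v

theorem bijective_bob_alice (d w : ℕ) :
    Function.Bijective fun G : PPCInput d w => (G.bob, G.alice) := by
  constructor
  · intro G H h
    obtain ⟨hb, ha⟩ := Prod.mk.injEq .. ▸ h
    have key : ∀ k, (G.1 k, G.2 k) = (H.1 k, H.2 k) := fun k => by
      rcases Nat.even_or_odd (k.val + 1) with hk | hk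
      · exact congrFun hb ⟨k, hk⟩
      · exact congrFun ha ⟨k, hk⟩
    exact Prod.ext (funext fun k => (Prod.ext_iff.1 (key k)).1)
      (funext fun k => (Prod.ext_iff.1 (key k)).2)
  · rintro ⟨x, y⟩
    set S : Fin (d - 1) → Equiv.Perm (Fin w) × Equiv.Perm (Fin w) := fun k =>
      if h : Even (k.val + 1) then x ⟨k, h⟩ else y ⟨k, Nat.not_even_iff_odd.1 h⟩ with hS
    refine ⟨(fun k => (S k).1, fun k => (S k).2), Prod.ext (funext fun k => ?_)
      (funext fun k => ?_)⟩
    · simp [PPCInput.bob, hS, k.2]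
    · simp [PPCInput.alice, hS, Nat.not_even_iff_odd.2 k.2]

theorem foldl_pairApply {w : ℕ} : ∀ (n : ℕ) (H : Fin n → Equiv.Perm (Fin w) × Equiv.Perm (Fin w))
    (a : Fin w × Fin w), Fin.foldl n (fun u j => pairApply (H j) u) a
      = (Fin.foldl n (fun u j => (H j).1 u) a.1, Fin.foldl n (fun u j => (H j).2 u) a.2)
  | 0, _, _ => by simp
  | n + 1, H, a => by
    simp only [Fin.foldl_succ]
    rw [foldl_pairApply n fun j => H j.succ]
    rfl

theorem chase_eq_foldl {w : ℕ} (S : ℕ → Equiv.Perm (Fin w) × Equiv.Perm (Fin w)) :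
    ∀ (n : ℕ) (mX mY : ℕ → Equiv.Perm (Fin w) × Equiv.Perm (Fin w)) (a : Fin w × Fin w),
    (∀ i ≤ n, Odd (n + i) → mX i = S i) → (∀ i ≤ n, Even (n + i) → mY i = S i) →
    chase n mX mY a = Fin.foldl (n + 1) (fun u j => pairApply (S (n - j)) u) a
  | 0, mX, mY, a, _, hY => by
    simp [chase, hY 0 le_rfl (by simp), Fin.foldl_succ]
  | n + 1, mX, mY, a, hX, hY => by
    rw [chase, chase_eq_foldl S n mY mX _ (fun i hi h => hY i (by omega) (by grind))
      (fun i hi h => hX i (by omega) (by grind)), Fin.foldl_succ (n := n + 1),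
      hY (n + 1) le_rfl (by grind)]
    simp

/-- Bob's pair of matchings with `i` matchings remaining after it. -/
def bobMatching {R w : ℕ} (i : ℕ) (x : BobInput (R + 2) w) :
    Equiv.Perm (Fin w) × Equiv.Perm (Fin w) :=
  -- The default 1 is never read: a chase of length R asks Bob only for indices i ≤ R with R + i
  -- odd.
  if h : i ≤ R ∧ Even (R - i + 1) then x ⟨⟨R - i, by omega⟩, h.2⟩ else 1

/-- Alice's pair of matchings with `i` matchings remaining after it. -/
def aliceMatching {R w : ℕ} (i : ℕ) (y : AliceInput (R + 2) w) :
    Equiv.Perm (Fin w) × Equiv.Perm (Fin w) :=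
  if h : i ≤ R ∧ Odd (R - i + 1) then y ⟨⟨R - i, by omega⟩, h.2⟩ else 1

theorem uniformlyDistributed_bobMatching {R w : ℕ} {i : ℕ} (hi : i ≤ R) (h : Odd (R + i)) :
    UniformlyDistributed (bobMatching (R := R) (w := w) i) := by
  intro F
  have hh : i ≤ R ∧ Even (R - i + 1) := ⟨hi, by grind⟩
  simp only [bobMatching, dif_pos hh]
  exact expect_pi_apply (ι := {k : Fin (R + 2 - 1) // Even (k.val + 1)}) _ F

theorem uniformlyDistributed_aliceMatching {R w : ℕ} {i : ℕ} (hi : i ≤ R) (h : Even (R + i)) :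
    UniformlyDistributed (aliceMatching (R := R) (w := w) i) := by
  intro F
  have hh : i ≤ R ∧ Odd (R - i + 1) := ⟨hi, by grind⟩
  simp only [aliceMatching, dif_pos hh]
  exact expect_pi_apply (ι := {k : Fin (R + 2 - 1) // Odd (k.val + 1)}) _ F

theorem chase_matchings {R w : ℕ} (G : PPCInput (R + 2) w) (v : Fin w) :
    chase R (fun i => bobMatching i G.bob) (fun i => aliceMatching i G.alice) (v, v)
      = (G.1.point v, G.2.point v) := by
  rw [chase_eq_foldl (fun i => if h : i ≤ R then
    (G.1 ⟨R - i, by omega⟩, G.2 ⟨R - i, by omega⟩) else 1)]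
  · rw [foldl_pairApply]
    have : ∀ j : Fin (R + 1), R - (R - (j : ℕ)) = j := fun j => by have := j.2; omega
    simp only [Nat.sub_le, dif_pos, this]
    rfl
  · intro i hi h
    have hh : i ≤ R ∧ Even (R - i + 1) := ⟨hi, by grind⟩
    simp only [bobMatching, dif_pos hh, dif_pos hi]
    rfl
  · intro i hi h
    have hh : i ≤ R ∧ Odd (R - i + 1) := ⟨hi, by grind⟩
    simp only [aliceMatching, dif_pos hh, dif_pos hi]
    rfl

/-! ### Protocols with a finite message alphabet. -/

/-- Replace by the empty string a message of more than `C` bits. -/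
def truncateMsg {X : Type} (C : ℕ) (f : X → List (List Bool) → List Bool) (x : X)
    (t : List (List Bool)) : List Bool :=
  if (f x t).length ≤ C then f x t else []

namespace DetProtocol

variable {X Y : Type} (π : DetProtocol X Y)

theorem length_transcript (x : X) (y : Y) : ∀ r, (π.transcript x y r).length = r
  | 0 => rfl
  | r + 1 => by simp [transcript, length_transcript x y r]

theorem length_nextMsg_le_cost [Fintype X] [Fintype Y] {R r : ℕ} (hr : r < R) (x : X) (y : Y) :
    (π.nextMsg x y (π.transcript x y r)).length ≤ π.cost R :=
  (Finset.le_sup (f := fun r => (π.nextMsg x y (π.transcript x y r)).length)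
    (Finset.mem_range.2 hr)).trans
    (Finset.le_sup (f := fun p : X × Y => (Finset.range R).sup fun r =>
      (π.nextMsg p.1 p.2 (π.transcript p.1 p.2 r)).length) (Finset.mem_univ (x, y)))

/-- The cost bounds messages on real transcripts only, whereas the induction needs a finite alphabet
on every history. Truncation supplies it without altering any real run; the parity of r says who
speaks. -/
theorem play_truncateMsg [Fintype X] [Fintype Y] {R : ℕ} (x : X) (y : Y) :
    ∀ j r, r + j = R →
    (Even r → play j (truncateMsg (π.cost R) π.bobMsg y) (π.bobOut y)
        (truncateMsg (π.cost R) π.aliceMsg x) (π.aliceOut x) (π.transcript x y r)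
        = π.output R x y) ∧
    (Odd r → play j (truncateMsg (π.cost R) π.aliceMsg x) (π.aliceOut x)
        (truncateMsg (π.cost R) π.bobMsg y) (π.bobOut y) (π.transcript x y r)
        = π.output R x y)
  | 0, r, h => by
    obtain rfl : r = R := by omega
    refine ⟨fun hr => ?_, fun hr => ?_⟩
    · simp [play, output, hr]
    · simp [play, output, hr]
  | j + 1, r, h => by
    have ih := play_truncateMsg (R := R) x y j (r + 1) (by omega)
    have hlen := π.length_nextMsg_le_cost (R := R) (r := r) (by omega) x y
    have hl := π.length_transcript x y r
    refine ⟨fun hr => ?_, fun hr => ?_⟩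
    · have e : π.nextMsg x y (π.transcript x y r) = π.bobMsg y (π.transcript x y r) := by
        rw [nextMsg, hl, if_pos (by grind)]
      rw [e] at hlen
      rw [play, ← ih.2 (by grind), truncateMsg, if_pos hlen, transcript, e]
    · have e : π.nextMsg x y (π.transcript x y r) = π.aliceMsg x (π.transcript x y r) := by
        rw [nextMsg, hl, if_neg (by grind)]
      rw [e] at hlen
      rw [play, ← ih.1 (by grind), truncateMsg, if_pos hlen, transcript, e]

end DetProtocol

theorem exists_finset_short_lists (C : ℕ) :
    ∃ msgs : Finset (List Bool), (∀ l : List Bool, l.length ≤ C → l ∈ msgs) ∧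
      msgs.card ≤ 4 ^ C := by
  refine ⟨(Finset.range (C + 1)).biUnion fun n =>
    Finset.univ.image fun v : Fin n → Bool => List.ofFn v, fun l hl => ?_, ?_⟩
  · rw [Finset.mem_biUnion]
    exact ⟨l.length, Finset.mem_range.2 (by omega), Finset.mem_image.2
      ⟨l.get, Finset.mem_univ _, List.ofFn_get l⟩⟩
  · refine Finset.card_biUnion_le.trans ((Finset.sum_le_sum (g := fun n => 2 ^ n) fun n _ =>
      Finset.card_image_le.trans_eq (by simp)).trans ?_)
    induction C with
    | zero => simp
    | succ C ih =>
      rw [Finset.sum_range_succ]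
      have : 2 ^ C ≤ 4 ^ C := Nat.pow_le_pow_left (by norm_num) C
      rw [pow_succ, pow_succ]
      omega

/-! ### From success probability to the lower bound. -/

theorem PPCProtocol.successProb_eq {n w : ℕ} [NeZero w] (π : PPCProtocol (n + 2) w) :
    π.successProb = 1 / 2 + 1 / 2 * 𝔼 G : PPCInput (n + 2) w,
      rejects (π.output n G.alice G.bob) * diagTest (G.1.point 0, G.2.point 0) := by
  classical
  have hw : (w : ℝ) ≠ 0 := Nat.cast_ne_zero.2 (NeZero.ne w)
  set out : PPCInput (n + 2) w → Bool := fun G => π.output n G.alice G.bob with hout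
  set E := PPCInput.equalPointers (n + 2) w with hE
  set N : ℝ := (Fintype.card (PPCInput (n + 2) w) : ℝ) with hN
  have hN0 : N ≠ 0 := by rw [hN]; exact_mod_cast Fintype.card_ne_zero
  have hEcard : (E.card : ℝ) * w = N := by
    have h1 := expect_points (n := n) (diagTest (w := w)) 0
    rw [expect_diagTest, Fintype.expect_eq_sum_div_card, div_eq_zero_iff, or_iff_left hN0] at h1
    simp only [diagTest, Finset.sum_sub_distrib, ← Finset.sum_filter, Finset.sum_const] at h1
    change _ - E.card • (w : ℝ) = 0 at h1
    simp only [nsmul_eq_mul, mul_one, Finset.card_univ] at h1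
    linarith
  have hE0 : (E.card : ℝ) ≠ 0 := fun h => hN0 (by rw [← hEcard, h, zero_mul])
  have sp : π.successProb = 1 / 2 * (((Finset.univ.filter fun G => out G = false).card : ℝ) / N)
      + 1 / 2 * (((E.filter fun G => out G = true).card : ℝ) / E.card) := by
    rw [PPCProtocol.successProb, muPPC, PMF.toOuterMeasure_bind_apply, tsum_fintype]
    simp only [PMF.toOuterMeasure_map_apply, muPPCGiven, Fintype.sum_bool, if_true,
      PMF.uniformOfFintype_apply, Fintype.card_bool, Bool.false_eq_true, if_false,
      PMF.toOuterMeasure_uniformOfFinset_apply, PMF.toOuterMeasure_uniformOfFintype_apply]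
    rw [ENNReal.toReal_add, ENNReal.toReal_mul, ENNReal.toReal_mul, ENNReal.toReal_div,
      ENNReal.toReal_div]
    · simp only [Fintype.card_subtype, Set.mem_preimage, Set.mem_ofPred_eq, Nat.add_sub_cancel,
        ENNReal.toReal_inv, ENNReal.toReal_natCast, ENNReal.toReal_ofNat, Nat.cast_ofNat]
      rw [add_comm, one_div]
    · exact ENNReal.mul_ne_top (by simp)
        (ENNReal.div_ne_top (by simp) (by exact_mod_cast fun h => hE0 (by exact_mod_cast h)))
    · exact ENNReal.mul_ne_top (by simp) (ENNReal.div_ne_top (by simp) (by simp))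
  have adv : ∑ G, rejects (out G) * diagTest (G.1.point 0, G.2.point 0)
      = ((Finset.univ.filter fun G => out G = false).card : ℝ)
        - ((E.filter fun G => out G = false).card : ℝ) * w := by
    have h1 : ∀ G : PPCInput (n + 2) w, rejects (out G) * diagTest (G.1.point 0, G.2.point 0)
        = (if out G = false then (1 : ℝ) else 0)
          - if G.1.point 0 = G.2.point 0 ∧ out G = false then (w : ℝ) else 0 := fun G => by
      by_cases h : out G = false <;> by_cases h' : G.1.point 0 = G.2.point 0 <;>
        simp [rejects, diagTest, h, h']
    rw [Finset.sum_congr rfl fun G _ => h1 G, Finset.sum_sub_distrib, ← Finset.sum_filter,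
      ← Finset.sum_filter, hE, PPCInput.equalPointers, Finset.filter_filter]
    simp
  have compl : ((E.filter fun G => out G = true).card : ℝ)
      = E.card - ((E.filter fun G => out G = false).card : ℝ) := by
    rw [← Finset.card_filter_add_card_filter_not (s := E) fun G => out G = true]
    simp
  rw [sp, Fintype.expect_eq_sum_div_card, adv, compl, ← hN, ← hEcard]
  field_simp
  ring

theorem rejection_advantage_le {R w : ℕ} [NeZero w] (π : PPCProtocol (R + 2) w) (lam s : ℝ)
    (hlam : 0 < lam) :
    ∃ K : ℕ, K ≠ 0 ∧ K ≤ 4 ^ π.cost R ∧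
    𝔼 G : PPCInput (R + 2) w,
      rejects (π.output R G.alice G.bob) * diagTest (G.1.point 0, G.2.point 0)
      ≤ ((s - 1) * R + Real.exp (-s) * Real.exp (4 * lam ^ 2 / w)
          * (R * ((K : ℝ) * (w : ℝ) ^ 2) ^ R * 2)) / lam := by
  obtain ⟨msgs, hmsgs, hcard⟩ := exists_finset_short_lists (π.cost R)
  have hmem : ∀ {X : Type} (f : X → List (List Bool) → List Bool) x t,
      truncateMsg (π.cost R) f x t ∈ msgs := fun f x t => hmsgs _ (by
    unfold truncateMsg; split_ifs with h
    · exact h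
    · simp)
  have hne : msgs.Nonempty := ⟨[], hmsgs _ (by simp)⟩
  refine ⟨msgs.card, hne.card_ne_zero, hcard, ?_⟩
  -- Bob speaks first although the first matching is Alice's: he starts as the player who knows the
  -- pair (0, 0).
  have main := advantage_le (w := w) msgs hne lam s hlam R
    (truncateMsg (π.cost R) π.bobMsg) π.bobOut (truncateMsg (π.cost R) π.aliceMsg) π.aliceOut
    (fun i => bobMatching (R := R) i) (fun i => aliceMatching (R := R) i)
    (fun _ => 1) (fun _ => 1) [] (fun _ => (0, 0)) (hmem _) (hmem _)
    (fun i hi h => uniformlyDistributed_bobMatching hi h)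
    (fun i hi h => uniformlyDistributed_aliceMatching hi h)
    (fun _ => by simp) (fun _ => by simp)
  have hgap : ∀ a, gap (fun _ => 1) (fun i => aliceMatching (R := R) (w := w) i) R a = 0 := fun a =>
    gap_one_eq_zero _ R (uniformlyDistributed_aliceMatching le_rfl (by grind)) a
  simp only [hgap, mul_zero, Finset.sum_const_zero, zero_add, Fintype.expect_const, mul_one,
    one_add_one_eq_two] at main
  refine le_trans (le_of_eq ?_) main
  unfold advantage
  rw [← Finset.expect_product', Finset.univ_product_univ]
  refine Fintype.expect_bijective _ (bijective_bob_alice (R + 2) w) _ _ fun G => ?_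
  rw [← chase_matchings G 0, ← (π.play_truncateMsg (R := R) G.alice G.bob R 0 (by simp)).1 (by simp)]
  simp [DetProtocol.transcript]

/-- The previous bound with the best choice of `s`. -/
theorem rejection_advantage_le_log {R w : ℕ} [NeZero w] (π : PPCProtocol (R + 2) w) (lam : ℝ)
    (hlam : 0 < lam) :
    𝔼 G : PPCInput (R + 2) w,
      rejects (π.output R G.alice G.bob) * diagTest (G.1.point 0, G.2.point 0)
      ≤ (Real.log 2 + R * (2 * π.cost R * Real.log 2 + 2 * Real.log w) + 4 * lam ^ 2 / w)
          * R / lam := by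
  have hw : (0 : ℝ) < w := Nat.cast_pos.2 (NeZero.pos w)
  set s := Real.log 2 + R * (2 * π.cost R * Real.log 2 + 2 * Real.log w) + 4 * lam ^ 2 / w with hs
  obtain ⟨K, hK0, hK, h⟩ := rejection_advantage_le π lam s hlam
  refine h.trans (div_le_div_of_nonneg_right ?_ hlam.le)
  have hQ : (K : ℝ) * (w : ℝ) ^ 2 ≤ Real.exp (2 * π.cost R * Real.log 2 + 2 * Real.log w) := by
    rw [Real.exp_add]
    refine mul_le_mul ?_ (le_of_eq ?_) (by positivity) (Real.exp_pos _).le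
    · have e : (2 * π.cost R * Real.log 2) = (π.cost R : ℝ) * Real.log 4 := by
        rw [show (4 : ℝ) = 2 ^ 2 by norm_num, Real.log_pow]; push_cast; ring
      rw [e, Real.exp_nat_mul, Real.exp_log (by norm_num)]
      exact_mod_cast hK
    · rw [← Real.exp_log hw, Real.log_exp, ← Real.exp_nat_mul]; norm_num
  have hQR : ((K : ℝ) * (w : ℝ) ^ 2) ^ R
      ≤ Real.exp (R * (2 * π.cost R * Real.log 2 + 2 * Real.log w)) := by
    rw [Real.exp_nat_mul]
    exact pow_le_pow_left₀ (by positivity) hQ R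
  -- This choice of s makes the exponential term at most R, which turns (s - 1)·R into s·R.
  have hone : Real.exp (-s) * Real.exp (4 * lam ^ 2 / w)
      * (Real.exp (R * (2 * π.cost R * Real.log 2 + 2 * Real.log w)) * 2) = 1 := by
    rw [← Real.exp_log (show (0 : ℝ) < 2 by norm_num), ← Real.exp_add, ← Real.exp_add,
      ← Real.exp_add, Real.exp_eq_one_iff, Real.exp_log (by norm_num), hs]
    ring
  have hle : Real.exp (-s) * Real.exp (4 * lam ^ 2 / w) * (((K : ℝ) * (w : ℝ) ^ 2) ^ R * 2) ≤ 1 := by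
    rw [← hone]; gcongr
  have := mul_le_mul_of_nonneg_right hle (Nat.cast_nonneg (α := ℝ) R)
  linarith

theorem lemma5 :
    ∃ c : ℝ, 0 < c ∧
      ∀ (d w : ℕ) [NeZero w], 2 ≤ d → 2 ≤ w →
        ∀ π : PPCProtocol d w, (0.95 : ℝ) ≤ PPCProtocol.successProb π →
          c * ((w : ℝ) / (d : ℝ) ^ 5 - Real.logb 2 (w : ℝ)) ≤ (DetProtocol.cost π (d - 2) : ℝ) := by
  -- Any constant in (0, 1] would do: only C + log₂ w ≤ w/d⁵ is drawn from the negated bound.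
  refine ⟨1 / 4, by norm_num, fun d w _ hd hw π hπ => ?_⟩
  obtain ⟨R, rfl⟩ := Nat.exists_eq_add_of_le' hd
  rw [Nat.add_sub_cancel]
  by_contra! hC
  have hw0 : (0 : ℝ) < w := by exact_mod_cast NeZero.pos w
  have hw2 : (2 : ℝ) ≤ w := by exact_mod_cast hw
  set C : ℝ := (DetProtocol.cost π R : ℝ) with hCdef
  have hC0 : 0 ≤ C := Nat.cast_nonneg _
  set D : ℝ := ((R + 2 : ℕ) : ℝ) with hD
  have hDR : D = R + 2 := by rw [hD]; push_cast; ring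
  have hR0 : (0 : ℝ) ≤ R := Nat.cast_nonneg R
  have hD0 : 0 < D := by linarith
  set l : ℝ := Real.logb 2 w with hl
  have hl1 : 1 ≤ l := by
    rw [hl, Real.le_logb_iff_rpow_le (by norm_num) hw0]; simpa using hw2
  have hlog : Real.log w = l * Real.log 2 := by
    rw [hl, Real.logb, div_mul_cancel₀ _ (Real.log_pos (by norm_num)).ne']
  set W : ℝ := w / D ^ 5 with hW
  have hwW : (w : ℝ) = W * D ^ 5 := by rw [hW]; field_simp
  have hCl : C + l ≤ W := by linarith
  have hW1 : 1 ≤ W := by linarith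
  -- This λ turns the variance term 4λR/w into R/(4D) ≤ 1/4.
  have adv := rejection_advantage_le_log π (w / (16 * D)) (by positivity)
  rw [PPCProtocol.successProb_eq] at hπ
  have hlog2 : Real.log 2 ≤ 0.7 := by linarith [Real.log_two_lt_d9]
  have hlog2' : 0 ≤ Real.log 2 := Real.log_nonneg (by norm_num)
  have e : (Real.log 2 + R * (2 * C * Real.log 2 + 2 * Real.log w)
        + 4 * (w / (16 * D)) ^ 2 / w) * R / (w / (16 * D))
      = Real.log 2 * (16 * D * R * (1 + 2 * R * (C + l))) / w + R / (4 * D) := by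
    rw [hlog]; field_simp; ring
  rw [← hCdef, e] at adv
  have k1 : R / (4 * D) ≤ 1 / 4 := by
    rw [div_le_div_iff₀ (by positivity) (by norm_num)]; linarith
  -- The other term is of order D·R²·(C + l)/w, so D⁵ leaves a spare D² to absorb the numerical
  -- constants.
  have b1 : 64 * (R : ℝ) ≤ D ^ 4 := by
    rw [hDR]
    nlinarith [sq_nonneg ((R : ℝ) - 2 / 3), pow_nonneg hR0 3, pow_nonneg hR0 4]
  have b2 : 64 * (R : ℝ) ^ 2 ≤ D ^ 4 := by
    have : 8 * (R : ℝ) ≤ D ^ 2 := by rw [hDR]; nlinarith [sq_nonneg ((R : ℝ) - 2)]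
    calc 64 * (R : ℝ) ^ 2 = (8 * R) ^ 2 := by ring
      _ ≤ (D ^ 2) ^ 2 := by gcongr
      _ = D ^ 4 := by ring
  have k2 : 16 * D * R * (1 + 2 * R * (C + l)) ≤ 3 / 4 * w := by
    calc 16 * D * R * (1 + 2 * R * (C + l))
        ≤ 16 * D * R * (W + 2 * R * W) := by gcongr
      _ = D * W / 4 * (64 * R + 2 * (64 * R ^ 2)) := by ring
      _ ≤ D * W / 4 * (D ^ 4 + 2 * D ^ 4) := by gcongr
      _ = 3 / 4 * w := by rw [hwW]; ring
  have k3 : Real.log 2 * (16 * D * R * (1 + 2 * R * (C + l))) / w ≤ 0.7 * (3 / 4) := by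
    rw [div_le_iff₀ hw0, mul_assoc (0.7 : ℝ)]
    exact mul_le_mul hlog2 k2 (by positivity) (by norm_num)
  -- The advantage is at most 0.525 + 0.25, below the required 0.9.
  norm_num at hπ k3
  linarith
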